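/- A form is a primitive, reduced, positive definite integral binary quadratic form $ax^2+bxy+cy^2$, where reduced means $|b|\le a\le c$, with $b\ge 0$ if $|b|=a$ or $a=c$. For an integer $\Delta$, let $S_\Delta$ be the (finite) set of all forms of discriminant $b^2-4ac=\Delta$, and let $h(\Delta)$ be the number of proper ($SL_2(\mathbb Z)$-) equivalence classes of primitive positive definite integral binary quadratic forms of discriminant $\Delta$. The principal form of discriminant $\Delta$ is $x^2-\frac{\Delta}{4}y^2$ if $\Delta\equiv 0\pmod 4$ and $x^2+xy+\frac{1-\Delta}{4}y^2$ if $\Delta\equiv 1\pmod 4$. Suppose that $h(\Delta)$ is odd. Then infinitely many positive integers are represented by all forms in $S_\Delta$. Explicitly, for every $m\in\mathbb Z$, every form in $S_\Delta$ represents $$m^2\prod_{ax^2+bxy+cy^2\in S_\Delta\text{ non-principal}} ac ,$$ and every form in $S_\Delta$ also represents $$m^2\prod_{ax^2+bxy+cy^2\in T} ac ,$$ where $T\subseteq S_\Delta$ is any set containing exactly one form from each (proper or improper, i.e. $GL_2(\mathbb Z)$-) equivalence class of non-principal forms in $S_\Delta$. -/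

import Mathlib

/-- An integral binary quadratic form `a x² + b x y + c y²`. -/
@[ext]
structure BinaryForm where
  a : ℤ
  b : ℤ
  c : ℤ
  deriving DecidableEq

namespace BinaryForm

/-- The value `Q(x, y)`. -/
def eval (Q : BinaryForm) (x y : ℤ) : ℤ := Q.a * x ^ 2 + Q.b * x * y + Q.c * y ^ 2

/-- The discriminant `b² - 4ac`. -/
def disc (Q : BinaryForm) : ℤ := Q.b ^ 2 - 4 * Q.a * Q.c

/-- The integer `n` is represented by `Q`. -/
def Represents (Q : BinaryForm) (n : ℤ) : Prop := ∃ x y : ℤ, Q.eval x y = n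

/-- `Q(x, y) > 0` for all `(x, y) ≠ (0, 0)`. -/
def PosDef (Q : BinaryForm) : Prop := ∀ x y : ℤ, (x, y) ≠ (0, 0) → 0 < Q.eval x y

/-- `gcd(a, b, c) = 1`. -/
def Primitive (Q : BinaryForm) : Prop := Int.gcd (Int.gcd Q.a Q.b) Q.c = 1

/-- `|b| ≤ a ≤ c`, and `b ≥ 0` if `|b| = a` or `a = c`. -/
def Reduced (Q : BinaryForm) : Prop :=
  |Q.b| ≤ Q.a ∧ Q.a ≤ Q.c ∧ (|Q.b| = Q.a ∨ Q.a = Q.c → 0 ≤ Q.b)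

/-- Proper equivalence: an integral change of variables of determinant `1`. -/
def ProperlyEquivalent (Q R : BinaryForm) : Prop :=
  ∃ p q r s : ℤ, p * s - q * r = 1 ∧
    ∀ x y : ℤ, R.eval x y = Q.eval (p * x + q * y) (r * x + s * y)

/-- Equivalence, proper or improper: an integral change of variables of determinant `±1`. -/
def Equivalent (Q R : BinaryForm) : Prop :=
  ∃ p q r s : ℤ, (p * s - q * r = 1 ∨ p * s - q * r = -1) ∧
    ∀ x y : ℤ, R.eval x y = Q.eval (p * x + q * y) (r * x + s * y)

theorem ProperlyEquivalent.refl (Q : BinaryForm) : Q.ProperlyEquivalent Q :=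
  ⟨1, 0, 0, 1, by norm_num, fun x y => by simp⟩

theorem ProperlyEquivalent.symm {Q R : BinaryForm} (h : Q.ProperlyEquivalent R) :
    R.ProperlyEquivalent Q := by
  obtain ⟨p, q, r, s, hd, h⟩ := h
  refine ⟨s, -q, -r, p, by linarith, fun x y => ?_⟩
  rw [h]
  have h1 : p * (s * x + -q * y) + q * (-r * x + p * y) = x := by linear_combination x * hd
  have h2 : r * (s * x + -q * y) + s * (-r * x + p * y) = y := by linear_combination y * hd
  rw [h1, h2]

theorem ProperlyEquivalent.trans {Q R S : BinaryForm} (h : Q.ProperlyEquivalent R)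
    (h' : R.ProperlyEquivalent S) : Q.ProperlyEquivalent S := by
  obtain ⟨p, q, r, s, hd, h⟩ := h
  obtain ⟨p', q', r', s', hd', h'⟩ := h'
  refine ⟨p * p' + q * r', p * q' + q * s', r * p' + s * r', r * q' + s * s', ?_, fun x y => ?_⟩
  · linear_combination (p' * s' - q' * r') * hd + hd'
  · rw [h', h]
    congr 1 <;> ring

/-- Proper equivalence on the primitive positive definite forms (reduced or not) of
discriminant `D`. -/
instance properSetoid (D : ℤ) :
    Setoid {Q : BinaryForm // Q.PosDef ∧ Q.Primitive ∧ Q.disc = D} where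
  r Q R := Q.1.ProperlyEquivalent R.1
  iseqv :=
    { refl := fun Q => ProperlyEquivalent.refl Q.1
      symm := fun h => h.symm
      trans := fun h h' => h.trans h' }

/-- The class number `h(D)`: the number of proper equivalence classes of primitive positive
definite forms of discriminant `D` (the underlying set of the class group). -/
noncomputable def classNumber (D : ℤ) : ℕ := Nat.card (Quotient (properSetoid D))

/-- The principal form of discriminant `D` (for `D ≡ 0, 1` modulo `4`). -/
def principal (D : ℤ) : BinaryForm :=
  if D % 4 = 0 then ⟨1, 0, -D / 4⟩ else ⟨1, 1, (1 - D) / 4⟩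

/-- There are only finitely many reduced positive definite forms of a given discriminant. -/
theorem finite_reduced (D : ℤ) :
    {Q : BinaryForm | Q.PosDef ∧ Q.Primitive ∧ Q.Reduced ∧ Q.disc = D}.Finite := by
  have hbox : (Set.Icc 0 (-D) ×ˢ (Set.Icc D (-D) ×ˢ Set.Icc 0 (-D)) : Set (ℤ × ℤ × ℤ)).Finite :=
    (Set.finite_Icc _ _).prod ((Set.finite_Icc _ _).prod (Set.finite_Icc _ _))
  refine (hbox.image fun t => (⟨t.1, t.2.1, t.2.2⟩ : BinaryForm)).subset ?_
  rintro ⟨a, b, c⟩ ⟨hp, -, ⟨hba, hac, -⟩, hD⟩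
  have ha : 0 < a := by simpa [eval] using hp 1 0 (by simp)
  simp only [disc] at hD hba hac
  obtain ⟨h1, h2⟩ := abs_le.mp hba
  have hb : b ^ 2 ≤ a * c := by nlinarith
  have hc : c ≤ a * c := by nlinarith
  refine ⟨(a, b, c), ?_, rfl⟩
  simp only [Set.mem_prod, Set.mem_Icc]
  refine ⟨⟨?_, ?_⟩, ⟨?_, ?_⟩, ?_, ?_⟩ <;> nlinarith

/-- `S_D`: the finite set of all reduced, primitive, positive definite forms of
discriminant `D`. -/
noncomputable def forms (D : ℤ) : Finset BinaryForm := (finite_reduced D).toFinset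

/-- The forms in `S_D` other than the principal form. -/
noncomputable def nonprincipalForms (D : ℤ) : Finset BinaryForm := (forms D).erase (principal D)

end BinaryForm

/-! Work in the class group of the order `ℤ[ω]`, `ω² = A + B ω`, of discriminant `D = B² + 4A < 0`.
A form `Q` gives the invertible ideal `(a, ρ)` of norm `a`, where `ρ = (-b + √D)/2`, and this
identifies proper equivalence classes of forms with ideal classes; so the class group has odd order.
If the inverse of the class of `Q` contains an ideal of norm `n`, then `Q` represents `n`
(`represents_of_classHasNorm`).

The number `ac` is a norm in two ways. As `N(ρ) = ac`, it is a norm from the principal class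
(`classHasNorm_one_mul`). As `(a, ρ)(c, ρ) = (ρ)`, the ideal `(a, ρ)` times the conjugate of `(c,
ρ)` has norm `ac` and lies in the square of the class of the form (`classHasNorm_sq_mul`);
conjugation then covers the inverse square.

In a group of odd order the inverse of the class of `Q` is some `g²`. If `g = 1`, read every factor
of the product as a principal norm. Otherwise `g` or `g⁻¹` is the class of a form in the product:
read its factor as a norm from `g²` and all others, with `m²`, as principal norms. -/

namespace QuadraticAlgebra

/-! ### Invertible ideals and their norms. -/

variable {A B : ℤ}

/-- The image of an ideal under conjugation. -/
noncomputable def conjIdeal (I : Ideal (QuadraticAlgebra ℤ A B)) :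
    Ideal (QuadraticAlgebra ℤ A B) :=
  I.map (starRingEnd (QuadraticAlgebra ℤ A B))

theorem conjIdeal_mul (I J : Ideal (QuadraticAlgebra ℤ A B)) :
    conjIdeal (I * J) = conjIdeal I * conjIdeal J := Ideal.map_mul _ _ _

theorem conjIdeal_span_singleton (x : QuadraticAlgebra ℤ A B) :
    conjIdeal (Ideal.span {x}) = Ideal.span {star x} := by
  simp [conjIdeal, Ideal.map_span, starRingEnd_apply]

theorem conjIdeal_span_pair (x y : QuadraticAlgebra ℤ A B) :
    conjIdeal (Ideal.span {x, y}) = Ideal.span {star x, star y} := by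
  simp [conjIdeal, Ideal.map_span, Set.image_pair, starRingEnd_apply]

theorem conjIdeal_conjIdeal (I : Ideal (QuadraticAlgebra ℤ A B)) :
    conjIdeal (conjIdeal I) = I := by
  simp only [conjIdeal, Ideal.map_map]
  convert Ideal.map_id I
  ext x <;> simp

theorem intCast_norm (x : QuadraticAlgebra ℤ A B) :
    ((norm x : ℤ) : QuadraticAlgebra ℤ A B) = x * star x := by
  simpa using algebraMap_norm_eq_mul_star x

theorem star_intCast' (n : ℤ) : star (n : QuadraticAlgebra ℤ A B) = n := by
  ext <;> simp

theorem intCast_dvd_iff {n : ℤ} {z : QuadraticAlgebra ℤ A B} :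
    (n : QuadraticAlgebra ℤ A B) ∣ z ↔ n ∣ z.re ∧ n ∣ z.im := by
  simpa using algebraMap_dvd_iff (r := n) (z := z)

/-- The ideal `I` is invertible of norm `n`. -/
def HasNorm (I : Ideal (QuadraticAlgebra ℤ A B)) (n : ℤ) : Prop :=
  0 < n ∧ I * conjIdeal I = Ideal.span {(n : QuadraticAlgebra ℤ A B)}

theorem HasNorm.mul {I J : Ideal (QuadraticAlgebra ℤ A B)} {n m : ℤ} (hI : HasNorm I n)
    (hJ : HasNorm J m) : HasNorm (I * J) (n * m) := by
  refine ⟨mul_pos hI.1 hJ.1, ?_⟩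
  rw [conjIdeal_mul, mul_mul_mul_comm, hI.2, hJ.2, Ideal.span_singleton_mul_span_singleton]
  push_cast
  rfl

theorem HasNorm.conj {I : Ideal (QuadraticAlgebra ℤ A B)} {n : ℤ} (hI : HasNorm I n) :
    HasNorm (conjIdeal I) n := by
  refine ⟨hI.1, ?_⟩
  rw [conjIdeal_conjIdeal, mul_comm, hI.2]

theorem hasNorm_span_singleton {x : QuadraticAlgebra ℤ A B} (hx : 0 < norm x) :
    HasNorm (Ideal.span {x}) (norm x) := by
  refine ⟨hx, ?_⟩
  rw [conjIdeal_span_singleton, Ideal.span_singleton_mul_span_singleton, intCast_norm]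

theorem hasNorm_one : HasNorm (1 : Ideal (QuadraticAlgebra ℤ A B)) 1 := by
  have := hasNorm_span_singleton (A := A) (B := B) (x := 1) (by simp)
  simpa using this

theorem HasNorm.unique {I : Ideal (QuadraticAlgebra ℤ A B)} {n m : ℤ} (hn : HasNorm I n)
    (hm : HasNorm I m) : n = m := by
  have h := hn.2.symm.trans hm.2
  refine Int.dvd_antisymm hn.1.le hm.1.le ?_ ?_
  · have := Ideal.span_singleton_le_span_singleton.1 h.ge
    simpa using (intCast_dvd_iff.1 this).1
  · have := Ideal.span_singleton_le_span_singleton.1 h.le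
    simpa using (intCast_dvd_iff.1 this).1

/-- Completing the square, `4 N(x) = (2 re + B im)² - D im²`. -/
theorem norm_pos_of_ne_zero (hD : B ^ 2 + 4 * A < 0) {x : QuadraticAlgebra ℤ A B}
    (hx : norm x ≠ 0) : 0 < norm x := by
  refine lt_of_le_of_ne ?_ hx.symm
  rw [norm_def]
  nlinarith [sq_nonneg (2 * x.re + B * x.im), mul_nonneg (neg_nonneg.2 hD.le) (sq_nonneg x.im)]

theorem HasNorm.norm_mul_eq (hD : B ^ 2 + 4 * A < 0) {I J : Ideal (QuadraticAlgebra ℤ A B)}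
    {n m : ℤ} (hI : HasNorm I n) (hJ : HasNorm J m) {x y : QuadraticAlgebra ℤ A B}
    (hx : norm x ≠ 0) (hy : norm y ≠ 0) (h : Ideal.span {x} * I = Ideal.span {y} * J) :
    norm x * n = norm y * m := by
  have h1 := (hasNorm_span_singleton (norm_pos_of_ne_zero hD hx)).mul hI
  have h2 := (hasNorm_span_singleton (norm_pos_of_ne_zero hD hy)).mul hJ
  rw [h] at h1
  exact h1.unique h2

theorem HasNorm.intCast_mem {I : Ideal (QuadraticAlgebra ℤ A B)} {n : ℤ} (hI : HasNorm I n) :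
    (n : QuadraticAlgebra ℤ A B) ∈ I :=
  Ideal.mul_le_right (I := conjIdeal I) (by rw [mul_comm, hI.2]; exact Ideal.mem_span_singleton_self _)

/-! ### The ideal class group. -/

variable (A B)

/-- The monoid of invertible ideals. -/
def normedIdeals : Submonoid (Ideal (QuadraticAlgebra ℤ A B)) where
  carrier := {I | ∃ n, HasNorm I n}
  one_mem' := ⟨1, hasNorm_one⟩
  mul_mem' := fun ⟨n, hn⟩ ⟨m, hm⟩ => ⟨n * m, hn.mul hm⟩

/-- Two invertible ideals are equivalent if they agree up to principal factors. -/
def idealCon : Con (normedIdeals A B) where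
  -- Nonvanishing of the norm is multiplicative, so transitivity does not need the order to be a
  -- domain.
  r I J := ∃ x y : QuadraticAlgebra ℤ A B, norm x ≠ 0 ∧ norm y ≠ 0 ∧
    Ideal.span {x} * I.1 = Ideal.span {y} * J.1
  iseqv :=
    { refl := fun I => ⟨1, 1, by simp, by simp, rfl⟩
      symm := fun ⟨x, y, hx, hy, h⟩ => ⟨y, x, hy, hx, h.symm⟩
      trans := by
        rintro I J K ⟨x, y, hx, hy, h⟩ ⟨z, w, hz, hw, h'⟩
        refine ⟨x * z, y * w, by simp [hx, hz], by simp [hy, hw], ?_⟩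
        rw [← Ideal.span_singleton_mul_span_singleton, ← Ideal.span_singleton_mul_span_singleton,
          mul_right_comm, h, mul_assoc, mul_assoc, ← h', mul_comm J.1] }
  mul' := by
    rintro I J K L ⟨x, y, hx, hy, h⟩ ⟨z, w, hz, hw, h'⟩
    refine ⟨x * z, y * w, by simp [hx, hz], by simp [hy, hw], ?_⟩
    rw [← Ideal.span_singleton_mul_span_singleton, ← Ideal.span_singleton_mul_span_singleton,
      Submonoid.coe_mul, Submonoid.coe_mul, mul_mul_mul_comm, h, h', mul_mul_mul_comm]

/-- The class group of the quadratic order `ℤ[ω]`, `ω² = A + B ω`. -/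
abbrev IdealClass := (idealCon A B).Quotient

variable {A B}

/-- The class of an invertible ideal. -/
def idealClass {I : Ideal (QuadraticAlgebra ℤ A B)} {n : ℤ} (hI : HasNorm I n) :
    IdealClass A B :=
  ((⟨I, n, hI⟩ : normedIdeals A B) : (idealCon A B).Quotient)

theorem idealClass_eq_iff {I J : Ideal (QuadraticAlgebra ℤ A B)} {n m : ℤ} (hI : HasNorm I n)
    (hJ : HasNorm J m) : idealClass hI = idealClass hJ ↔
      ∃ x y : QuadraticAlgebra ℤ A B, norm x ≠ 0 ∧ norm y ≠ 0 ∧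
        Ideal.span {x} * I = Ideal.span {y} * J :=
  Con.eq _

theorem idealClass_mul {I J : Ideal (QuadraticAlgebra ℤ A B)} {n m : ℤ} (hI : HasNorm I n)
    (hJ : HasNorm J m) : idealClass (hI.mul hJ) = idealClass hI * idealClass hJ := rfl

theorem idealClass_eq_one_iff {I : Ideal (QuadraticAlgebra ℤ A B)} {n : ℤ} (hI : HasNorm I n) :
    idealClass hI = 1 ↔ ∃ x y : QuadraticAlgebra ℤ A B, norm x ≠ 0 ∧ norm y ≠ 0 ∧
        Ideal.span {x} * I = Ideal.span {y} := by
  have h1 : (1 : IdealClass A B) = idealClass hasNorm_one := rfl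
  rw [h1, idealClass_eq_iff hI hasNorm_one]
  simp only [mul_one]

theorem idealClass_eq_one_of_eq_span {I : Ideal (QuadraticAlgebra ℤ A B)} {n : ℤ}
    (hI : HasNorm I n) {x : QuadraticAlgebra ℤ A B} (hx : norm x ≠ 0)
    (h : I = Ideal.span {x}) : idealClass hI = 1 :=
  (idealClass_eq_one_iff hI).2 ⟨1, x, by simp, hx, by simp [h]⟩

theorem idealClass_mul_conj {I : Ideal (QuadraticAlgebra ℤ A B)} {n : ℤ} (hI : HasNorm I n) :
    idealClass hI * idealClass hI.conj = 1 := by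
  rw [← idealClass_mul]
  exact idealClass_eq_one_of_eq_span _ (by simpa using hI.1.ne') hI.2

theorem exists_idealClass_eq (g : IdealClass A B) :
    ∃ (I : Ideal (QuadraticAlgebra ℤ A B)) (n : ℤ) (hI : HasNorm I n), idealClass hI = g := by
  induction g using Con.induction_on with
  | H I => exact ⟨I.1, I.2.choose, I.2.choose_spec, rfl⟩

theorem isUnit_idealClass (g : IdealClass A B) : IsUnit g := by
  obtain ⟨I, n, hI, rfl⟩ := exists_idealClass_eq g
  exact IsUnit.of_mul_eq_one _ (idealClass_mul_conj hI)

noncomputable instance : CommGroup (IdealClass A B) := commGroupOfIsUnit isUnit_idealClass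

/-! ### Norms occurring in a class. -/

/-- The class `g` contains an ideal of norm `n`. -/
def ClassHasNorm (g : IdealClass A B) (n : ℤ) : Prop :=
  ∃ (I : Ideal (QuadraticAlgebra ℤ A B)) (hI : HasNorm I n), idealClass hI = g

theorem ClassHasNorm.mul {g h : IdealClass A B} {n m : ℤ} (hg : ClassHasNorm g n)
    (hh : ClassHasNorm h m) : ClassHasNorm (g * h) (n * m) := by
  obtain ⟨I, hI, rfl⟩ := hg
  obtain ⟨J, hJ, rfl⟩ := hh
  exact ⟨I * J, hI.mul hJ, idealClass_mul hI hJ⟩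

theorem ClassHasNorm.inv {g : IdealClass A B} {n : ℤ} (hg : ClassHasNorm g n) :
    ClassHasNorm g⁻¹ n := by
  obtain ⟨I, hI, rfl⟩ := hg
  exact ⟨_, hI.conj, eq_inv_of_mul_eq_one_right (idealClass_mul_conj hI)⟩

theorem classHasNorm_one_norm {x : QuadraticAlgebra ℤ A B} (hx : 0 < norm x) :
    ClassHasNorm (1 : IdealClass A B) (norm x) :=
  ⟨_, hasNorm_span_singleton hx, idealClass_eq_one_of_eq_span _ hx.ne' rfl⟩

theorem classHasNorm_one_prod {ι : Type*} (s : Finset ι) (f : ι → ℤ)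
    (h : ∀ i ∈ s, ClassHasNorm (1 : IdealClass A B) (f i)) :
    ClassHasNorm (1 : IdealClass A B) (∏ i ∈ s, f i) := by
  refine Finset.prod_induction f (fun n => ClassHasNorm (1 : IdealClass A B) n) ?_ ?_ h
  · intro a b ha hb
    simpa using ha.mul hb
  · exact ⟨1, hasNorm_one, rfl⟩

end QuadraticAlgebra

namespace BinaryForm

open QuadraticAlgebra

variable {A B : ℤ} {Q R : BinaryForm}

/-! ### Positive definite and primitive forms. -/

theorem PosDef.a_pos (h : Q.PosDef) : 0 < Q.a := by
  simpa [eval] using h 1 0 (by simp)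

theorem PosDef.c_pos (h : Q.PosDef) : 0 < Q.c := by
  simpa [eval] using h 0 1 (by simp)

theorem PosDef.disc_neg (h : Q.PosDef) : Q.disc < 0 := by
  have ha := h.a_pos
  have := h (-Q.b) (2 * Q.a) (by simp [ha.ne'])
  simp only [eval] at this
  simp only [disc]
  nlinarith

theorem posDef_of_disc_neg (ha : 0 < Q.a) (hD : Q.disc < 0) : Q.PosDef := by
  intro x y hxy
  simp only [disc] at hD
  have h4 : 4 * Q.a * Q.eval x y =
      (2 * Q.a * x + Q.b * y) ^ 2 + (4 * Q.a * Q.c - Q.b ^ 2) * y ^ 2 := by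
    simp only [eval]; ring
  have : 0 < 4 * Q.a * Q.eval x y := by
    rw [h4]
    by_cases hy : y = 0
    · subst hy
      have hx : x ≠ 0 := by rintro rfl; exact hxy rfl
      have : (2 * Q.a * x + Q.b * 0) ≠ 0 := by simp [ha.ne', hx]
      have := pow_pos (abs_pos.2 this) 2
      rw [sq_abs] at this
      linarith
    · have h1 : 0 < (4 * Q.a * Q.c - Q.b ^ 2) * y ^ 2 := mul_pos (by linarith) (by positivity)
      exact add_pos_of_nonneg_of_pos (sq_nonneg _) h1
  exact (mul_pos_iff_of_pos_left (by linarith)).1 this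

theorem primitive_iff : Q.Primitive ↔ ∃ u v w : ℤ, u * Q.a + v * Q.b + w * Q.c = 1 := by
  constructor
  · intro h
    refine ⟨Int.gcdA (Int.gcd Q.a Q.b) Q.c * Int.gcdA Q.a Q.b,
      Int.gcdA (Int.gcd Q.a Q.b) Q.c * Int.gcdB Q.a Q.b, Int.gcdB (Int.gcd Q.a Q.b) Q.c, ?_⟩
    have h1 := Int.gcd_eq_gcd_ab Q.a Q.b
    have h2 := Int.gcd_eq_gcd_ab (Int.gcd Q.a Q.b) Q.c
    rw [show Int.gcd (Int.gcd Q.a Q.b) Q.c = 1 from h] at h2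
    push_cast at h2
    linear_combination -h2 - Int.gcdA (Int.gcd Q.a Q.b) Q.c * h1
  · rintro ⟨u, v, w, h⟩
    have h1 : ((Int.gcd (Int.gcd Q.a Q.b) Q.c : ℕ) : ℤ) ∣ 1 := by
      have hg := Int.gcd_dvd_left (Int.gcd Q.a Q.b : ℤ) Q.c
      rw [← h]
      exact ((((hg.trans (Int.gcd_dvd_left _ _)).mul_left _).add
        ((hg.trans (Int.gcd_dvd_right _ _)).mul_left _)).add
        ((Int.gcd_dvd_right _ _).mul_left _))
    have h2 := Int.eq_one_of_dvd_one (by positivity) h1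
    exact_mod_cast h2

/-! ### The ideal of a form. -/

variable (A B) in
/-- The quadratic irrationality `(-b + √D) / 2` in the order of discriminant `D = B² + 4A`. -/
def root (Q : BinaryForm) : QuadraticAlgebra ℤ A B := ⟨(-Q.b - B) / 2, 1⟩

variable (A B) in
/-- The ideal with basis `a`, `(-b + √D) / 2`. -/
noncomputable def ideal (Q : BinaryForm) : Ideal (QuadraticAlgebra ℤ A B) :=
  Ideal.span {(Q.a : QuadraticAlgebra ℤ A B), root A B Q}

theorem root_im : (root A B Q).im = 1 := rfl

/-- The division in `root` is exact because equal discriminants force `b` and `B` to have the same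
parity. -/
theorem two_mul_root_re (h : Q.disc = B ^ 2 + 4 * A) : 2 * (root A B Q).re = -Q.b - B := by
  refine Int.mul_ediv_cancel' ?_
  have h1 : Even (Q.b ^ 2 - B ^ 2) := by
    simp only [disc] at h
    exact ⟨2 * A + 2 * Q.a * Q.c, by linarith⟩
  have h2 : Even (-Q.b - B) := by
    simp only [Int.even_sub, Int.even_pow, even_neg] at h1 ⊢
    simpa using h1
  exact h2.two_dvd

theorem norm_root (h : Q.disc = B ^ 2 + 4 * A) : QuadraticAlgebra.norm (root A B Q) = Q.a * Q.c := by
  have h2 := two_mul_root_re h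
  simp only [disc] at h
  rw [norm_def, root_im]
  set k := (root A B Q).re
  have hb : Q.b = -B - 2 * k := by linarith
  rw [hb] at h
  linarith

theorem root_quad (h : Q.disc = B ^ 2 + 4 * A) :
    (root A B Q).re ^ 2 + B * (root A B Q).re - A = Q.a * Q.c := by
  rw [← norm_root h, norm_def, root_im]; ring

theorem root_mul_star (h : Q.disc = B ^ 2 + 4 * A) :
    root A B Q * star (root A B Q) = (Q.a : QuadraticAlgebra ℤ A B) * Q.c := by
  rw [← intCast_norm, norm_root h]; push_cast; rfl

theorem root_add_star (h : Q.disc = B ^ 2 + 4 * A) :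
    root A B Q + star (root A B Q) = -(Q.b : QuadraticAlgebra ℤ A B) := by
  have h2 := two_mul_root_re h
  ext
  · simp [root_im]; linarith
  · simp

theorem root_mul_self (h : Q.disc = B ^ 2 + 4 * A) :
    root A B Q * root A B Q = -(Q.b : QuadraticAlgebra ℤ A B) * root A B Q - Q.a * Q.c := by
  linear_combination root A B Q * root_add_star h - root_mul_star h

theorem mem_ideal_iff (h : Q.disc = B ^ 2 + 4 * A) (z : QuadraticAlgebra ℤ A B) :
    z ∈ ideal A B Q ↔ ∃ u v : ℤ, z = u * Q.a + v * root A B Q := by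
  rw [ideal, Ideal.mem_span_pair]
  constructor
  · rintro ⟨x, y, rfl⟩
    have hk := root_quad h
    set k := (root A B Q).re with hkdef
    refine ⟨x.re - x.im * k - y.im * Q.c, x.im * Q.a + y.re + y.im * (B + k), ?_⟩
    ext
    · simp [root_im, ← hkdef]; linear_combination -y.im * hk
    · simp [root_im, ← hkdef]; ring
  · rintro ⟨u, v, rfl⟩
    exact ⟨u, v, rfl⟩

/-- The norm of an element of the ideal of `Q`, in terms of `Q`. -/
theorem norm_mem_ideal (h : Q.disc = B ^ 2 + 4 * A) (u v : ℤ) :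
    QuadraticAlgebra.norm (u * Q.a + v * root A B Q : QuadraticAlgebra ℤ A B) =
      Q.a * Q.eval u (-v) := by
  have hk := root_quad h
  have h2 := two_mul_root_re h
  rw [norm_def]
  simp [root_im, eval]
  set k := (root A B Q).re with hkdef
  linear_combination v ^ 2 * hk + u * v * Q.a * h2

theorem mem_span_four {S : Type*} [CommRing S] {w x y z t : S} (a b c d : S)
    (h : t = a * w + b * x + c * y + d * z) : t ∈ Ideal.span ({w, x, y, z} : Set S) := by
  rw [h]
  refine add_mem (add_mem (add_mem ?_ ?_) ?_) ?_ <;>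
    exact Ideal.mul_mem_left _ _ (Ideal.subset_span (by simp))

/-- The product with the conjugate is `a · (a, ρ, ρ̄, c)`. Since `ρ + ρ̄ = -b`, the second factor
contains `a`, `b` and `c`, hence `1` by primitivity. -/
theorem hasNorm_ideal (h : Q.disc = B ^ 2 + 4 * A) (ha : 0 < Q.a) (hp : Q.Primitive) :
    HasNorm (ideal A B Q) Q.a := by
  refine ⟨ha, ?_⟩
  have hm := root_mul_star h
  have ht := root_add_star h
  rw [ideal, conjIdeal_span_pair, Ideal.span_pair_mul_span_pair, star_intCast']
  apply le_antisymm
  · rw [Ideal.span_le]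
    rintro z (rfl | rfl | rfl | rfl) <;>
      simp only [SetLike.mem_coe, Ideal.mem_span_singleton]
    · exact dvd_mul_right _ _
    · exact dvd_mul_right _ _
    · exact dvd_mul_left _ _
    · rw [hm]; exact dvd_mul_right _ _
  · obtain ⟨u, v, w, huvw⟩ := primitive_iff.1 hp
    rw [Ideal.span_singleton_le_iff_mem]
    have huvw' : (u : QuadraticAlgebra ℤ A B) * Q.a + v * Q.b + w * Q.c = 1 := by
      exact_mod_cast congrArg (Int.cast : ℤ → QuadraticAlgebra ℤ A B) huvw
    refine mem_span_four u (-v) (-v) w ?_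
    linear_combination -(Q.a : QuadraticAlgebra ℤ A B) * huvw' + v * Q.a * ht - w * hm

/-! ### Swapped and opposite forms. -/

/-- The form `c x² + b x y + a y²`. -/
def swap (Q : BinaryForm) : BinaryForm := ⟨Q.c, Q.b, Q.a⟩

/-- The form `a x² - b x y + c y²`. -/
def opp (Q : BinaryForm) : BinaryForm := ⟨Q.a, -Q.b, Q.c⟩

theorem disc_swap : Q.swap.disc = Q.disc := by simp only [disc, swap]; ring

theorem disc_opp : Q.opp.disc = Q.disc := by simp only [disc, opp]; ring

theorem Primitive.swap (h : Q.Primitive) : Q.swap.Primitive := by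
  obtain ⟨u, v, w, h⟩ := primitive_iff.1 h
  exact primitive_iff.2 ⟨w, v, u, by simp only [BinaryForm.swap]; linarith⟩

theorem Primitive.opp (h : Q.Primitive) : Q.opp.Primitive := by
  obtain ⟨u, v, w, h⟩ := primitive_iff.1 h
  exact primitive_iff.2 ⟨u, -v, w, by simp only [BinaryForm.opp]; linarith⟩

/-- Both forms share the root `ρ`, and `ac = ρ ρ̄`, so the product is `ρ · (ρ̄, a, c, ρ)`; the
second factor is again the unit ideal by primitivity. -/
theorem ideal_mul_ideal_swap (h : Q.disc = B ^ 2 + 4 * A) (hp : Q.Primitive) :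
    ideal A B Q * ideal A B Q.swap = Ideal.span {root A B Q} := by
  have hr : root A B Q.swap = root A B Q := rfl
  have hc : Q.swap.a = Q.c := rfl
  have hm := root_mul_star h
  have hs := root_mul_self h
  rw [ideal, ideal, Ideal.span_pair_mul_span_pair, hr, hc]
  apply le_antisymm
  · rw [Ideal.span_le]
    rintro z (rfl | rfl | rfl | rfl) <;>
      simp only [SetLike.mem_coe, Ideal.mem_span_singleton]
    · rw [← hm]; exact dvd_mul_right _ _
    · exact dvd_mul_left _ _
    · exact dvd_mul_right _ _
    · exact dvd_mul_left _ _
  · obtain ⟨u, v, w, huvw⟩ := primitive_iff.1 hp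
    rw [Ideal.span_singleton_le_iff_mem]
    have huvw' : (u : QuadraticAlgebra ℤ A B) * Q.a + v * Q.b + w * Q.c = 1 := by
      exact_mod_cast congrArg (Int.cast : ℤ → QuadraticAlgebra ℤ A B) huvw
    refine mem_span_four (-v) u w (-v) ?_
    linear_combination -(root A B Q) * huvw' + v * hs

theorem ideal_opp (h : Q.disc = B ^ 2 + 4 * A) : ideal A B Q.opp = conjIdeal (ideal A B Q) := by
  have hr : star (root A B Q) = -root A B Q.opp := by
    have h1 := two_mul_root_re h
    have h2 := two_mul_root_re (disc_opp.trans h)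
    have h3 : Q.opp.b = -Q.b := rfl
    ext
    · simp [root_im]; linarith
    · simp [root_im]
  rw [ideal, ideal, conjIdeal_span_pair, star_intCast', hr]
  have hc : Q.opp.a = Q.a := rfl
  rw [hc]
  apply le_antisymm <;> rw [Ideal.span_le]
  · rintro z (rfl | rfl)
    · exact Ideal.subset_span (by simp)
    · rw [SetLike.mem_coe, ← neg_mem_iff]
      exact Ideal.subset_span (by simp)
  · rintro z (rfl | rfl)
    · exact Ideal.subset_span (by simp)
    · rw [SetLike.mem_coe, neg_mem_iff]
      exact Ideal.subset_span (by simp)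

/-! ### From proper equivalence to equivalent ideals. -/

theorem coeff_of_eval {p q r s : ℤ}
    (h : ∀ x y : ℤ, R.eval x y = Q.eval (p * x + q * y) (r * x + s * y)) :
    R.a = Q.a * p ^ 2 + Q.b * p * r + Q.c * r ^ 2 ∧
      R.b = 2 * Q.a * p * q + Q.b * (p * s + q * r) + 2 * Q.c * r * s ∧
      R.c = Q.a * q ^ 2 + Q.b * q * s + Q.c * s ^ 2 := by
  have h1 := h 1 0
  have h2 := h 0 1
  have h3 := h 1 1
  simp only [eval] at h1 h2 h3
  refine ⟨by linarith, by linarith, by linarith⟩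

theorem ProperlyEquivalent.disc_eq (h : Q.ProperlyEquivalent R) : R.disc = Q.disc := by
  obtain ⟨p, q, r, s, hd, h⟩ := h
  obtain ⟨h1, h2, h3⟩ := coeff_of_eval h
  simp only [disc, h1, h2, h3]
  linear_combination (p * s - q * r + 1) * (Q.b ^ 2 - 4 * Q.a * Q.c) * hd

theorem ProperlyEquivalent.primitive (h : Q.ProperlyEquivalent R) (hR : R.Primitive) :
    Q.Primitive := by
  obtain ⟨p, q, r, s, hd, h⟩ := h
  obtain ⟨h1, h2, h3⟩ := coeff_of_eval h
  obtain ⟨u, v, w, hu⟩ := primitive_iff.1 hR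
  rw [h1, h2, h3] at hu
  exact primitive_iff.2 ⟨u * p ^ 2 + v * 2 * p * q + w * q ^ 2,
    u * p * r + v * (p * s + q * r) + w * q * s, u * r ^ 2 + 2 * v * r * s + w * s ^ 2,
    by linear_combination hu⟩

theorem ProperlyEquivalent.posDef (h : Q.ProperlyEquivalent R) (hQ : Q.PosDef) : R.PosDef := by
  obtain ⟨p, q, r, s, hd, h⟩ := h
  intro x y hxy
  rw [h]
  refine hQ _ _ fun h0 => hxy ?_
  simp only [Prod.mk.injEq] at h0 ⊢
  constructor
  · linear_combination s * h0.1 - q * h0.2 - x * hd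
  · linear_combination p * h0.2 - r * h0.1 - y * hd

/-- Properly equivalent forms have equivalent ideals. -/
theorem ProperlyEquivalent.exists_span_mul_ideal_eq (h : Q.ProperlyEquivalent R)
    (hQ : Q.disc = B ^ 2 + 4 * A) (hp : Q.PosDef) :
    ∃ x y : QuadraticAlgebra ℤ A B, QuadraticAlgebra.norm x ≠ 0 ∧ QuadraticAlgebra.norm y ≠ 0 ∧
      Ideal.span {x} * ideal A B Q = Ideal.span {y} * ideal A B R := by
  have hR : R.disc = B ^ 2 + 4 * A := h.disc_eq.trans hQ
  have hRp := h.posDef hp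
  obtain ⟨p, q, r, s, hd, h⟩ := h
  obtain ⟨h1, h2, h3⟩ := coeff_of_eval h
  have hk := two_mul_root_re hQ
  have hkR := two_mul_root_re hR
  have hq := root_quad hQ
  -- Multiplication by `α` sends the basis `R.a`, `root R` of the ideal of `R` to `R.a` times a
  -- unimodular change of the basis of the ideal of `Q`.
  set α : QuadraticAlgebra ℤ A B := (p : QuadraticAlgebra ℤ A B) * Q.a - r * root A B Q with hα
  have hαR : α * root A B R = R.a * (s * root A B Q - q * Q.a) := by
    have hk' : (root A B R).re =
        (root A B Q).re - Q.a * p * q - Q.b * q * r - Q.c * r * s := by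
      have : 2 * (root A B R).re =
          2 * ((root A B Q).re - Q.a * p * q - Q.b * q * r - Q.c * r * s) := by
        linear_combination hkR - hk - h2 - Q.b * hd
      exact mul_left_cancel₀ two_ne_zero this
    ext
    · simp [hα, root_im]
      rw [hk', h1]
      linear_combination -(r * Q.a * Q.c + p * Q.a * (root A B Q).re + Q.b * (root A B Q).re * r)
        * hd + r * hq - r * (root A B Q).re * hk
    · simp [hα, root_im]
      rw [hk', h1]
      linear_combination -(p * Q.a + Q.b * r) * hd - r * hk
  have hαn : QuadraticAlgebra.norm α = Q.a * R.a := by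
    have := norm_mem_ideal hQ p (-r)
    rw [neg_neg, show Q.eval p r = R.a by rw [h1, eval]] at this
    rw [← this, hα]
    congr 1
    push_cast
    ring
  have hd' : (p : QuadraticAlgebra ℤ A B) * s - q * r = 1 := by
    exact_mod_cast congrArg (Int.cast : ℤ → QuadraticAlgebra ℤ A B) hd
  refine ⟨R.a, α, by simpa using hRp.a_pos.ne', ?_, ?_⟩
  · rw [hαn]; exact (mul_pos hp.a_pos hRp.a_pos).ne'
  · rw [ideal, ideal, Ideal.span_mul_span', Ideal.span_mul_span', Set.singleton_mul,
      Set.singleton_mul, Set.image_pair, Set.image_pair]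
    apply le_antisymm <;> rw [Ideal.span_le]
    · rintro z (rfl | rfl) <;> rw [SetLike.mem_coe, Ideal.mem_span_pair]
      · refine ⟨s, r, ?_⟩
        linear_combination r * hαR + R.a * Q.a * hd' + s * R.a * hα
      · refine ⟨q, p, ?_⟩
        linear_combination p * hαR + R.a * root A B Q * hd' + q * R.a * hα
    · rintro z (rfl | rfl) <;> rw [SetLike.mem_coe, Ideal.mem_span_pair]
      · exact ⟨p, -r, by rw [hα]; ring⟩
      · exact ⟨-q, s, by linear_combination -hαR⟩

end BinaryForm

/-! ### From ideals back to forms. -/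

namespace BinaryForm

open QuadraticAlgebra

variable {A B : ℤ} {Q R : BinaryForm}

/-- Forms with equivalent ideals are properly equivalent. -/
theorem properlyEquivalent_of_span_mul_ideal_eq (hD : B ^ 2 + 4 * A < 0)
    (hQ : Q.disc = B ^ 2 + 4 * A) (hR : R.disc = B ^ 2 + 4 * A) (hQa : 0 < Q.a) (hRa : 0 < R.a)
    (hQp : Q.Primitive) (hRp : R.Primitive) {x y : QuadraticAlgebra ℤ A B}
    (hx : QuadraticAlgebra.norm x ≠ 0) (hy : QuadraticAlgebra.norm y ≠ 0)
    (h : Ideal.span {x} * ideal A B Q = Ideal.span {y} * ideal A B R) :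
    Q.ProperlyEquivalent R := by
  have hn := (hasNorm_ideal hQ hQa hQp).norm_mul_eq hD (hasNorm_ideal hR hRa hRp) hx hy h
  have mem : ∀ z ∈ ideal A B R, ∃ u v : ℤ, y * z = x * (u * Q.a + v * root A B Q) := by
    intro z hz
    have h1 : y * z ∈ Ideal.span {y} * ideal A B R :=
      Ideal.mul_mem_mul (Ideal.mem_span_singleton_self y) hz
    rw [← h, Ideal.mem_span_singleton_mul] at h1
    obtain ⟨w, hw, hwz⟩ := h1
    obtain ⟨u, v, rfl⟩ := (mem_ideal_iff hQ w).1 hw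
    exact ⟨u, v, hwz.symm⟩
  obtain ⟨p, r, h1⟩ := mem R.a (Ideal.subset_span (by simp))
  obtain ⟨q, s, h2⟩ := mem (root A B R) (Ideal.subset_span (by simp))
  have hNy : 0 < QuadraticAlgebra.norm y * R.a := mul_pos (norm_pos_of_ne_zero hD hy) hRa
  -- The signs come from `norm_mem_ideal`, where the coefficient of the root enters negated.
  refine ⟨p, -q, -r, s, ?_, fun X Y => ?_⟩
  -- The imaginary part of one basis element times the conjugate of the other is the determinant up
  -- to the factor `Q.a`; comparing norms makes it `1`.
  · have e1 : y * star y * R.a * root A B R =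
        x * star x * (star (p * Q.a + r * root A B Q) * (q * Q.a + s * root A B Q)) := by
      have h1' := congrArg star h1
      simp only [star_mul', star_intCast'] at h1' ⊢
      linear_combination star y * R.a * h2 + x * (q * Q.a + s * root A B Q) * h1'
    rw [← intCast_norm, ← intCast_norm] at e1
    have e2 := congrArg QuadraticAlgebra.im e1
    simp [root_im] at e2
    refine mul_left_cancel₀ hNy.ne' ?_
    linear_combination -e2 - (p * s - q * r) * hn
  · have e : y * (X * R.a + ((-Y : ℤ) : QuadraticAlgebra ℤ A B) * root A B R) =
        x * (((p * X - q * Y : ℤ) : QuadraticAlgebra ℤ A B) * Q.a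
          + ((r * X - s * Y : ℤ) : QuadraticAlgebra ℤ A B) * root A B Q) := by
      push_cast
      linear_combination X * h1 - Y * h2
    have e2 := congrArg QuadraticAlgebra.norm e
    rw [map_mul, map_mul, norm_mem_ideal hR, norm_mem_ideal hQ, neg_neg] at e2
    refine mul_left_cancel₀ hNy.ne' ?_
    rw [show p * X + -q * Y = p * X - q * Y by ring,
      show -r * X + s * Y = -(r * X - s * Y) by ring]
    linear_combination e2 + Q.eval (p * X - q * Y) (-(r * X - s * Y)) * hn

/-- If `d` divides all coefficients, then `ρ · (a, ρ) ⊆ d · (a, ρ)`, because `ρ² = -bρ - ac`.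
Invertibility cancels the ideal, so `d` divides `ρ`, whose second coordinate is `1`. -/
theorem primitive_of_hasNorm_ideal (hQ : Q.disc = B ^ 2 + 4 * A) {g n : ℤ}
    (h : HasNorm (Ideal.span {(g : QuadraticAlgebra ℤ A B)} * ideal A B Q) n) : Q.Primitive := by
  set d : ℤ := ((Int.gcd (Int.gcd Q.a Q.b) Q.c : ℕ) : ℤ) with hd
  have hgd : d ∣ Int.gcd Q.a Q.b := Int.gcd_dvd_left _ _
  obtain ⟨a, ha⟩ : d ∣ Q.a := hgd.trans (Int.gcd_dvd_left _ _)
  obtain ⟨b, hb⟩ : d ∣ Q.b := hgd.trans (Int.gcd_dvd_right _ _)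
  obtain ⟨c, hc⟩ : d ∣ Q.c := Int.gcd_dvd_right _ _
  have hle : Ideal.span {root A B Q} * ideal A B Q ≤
      Ideal.span {(d : QuadraticAlgebra ℤ A B)} * ideal A B Q := by
    rw [ideal, Ideal.span_mul_span', Set.singleton_mul, Set.image_pair, Ideal.span_le]
    have hr : root A B Q ∈ ideal A B Q := Ideal.subset_span (by simp)
    have hqa : (Q.a : QuadraticAlgebra ℤ A B) ∈ ideal A B Q := Ideal.subset_span (by simp)
    rintro z (rfl | rfl) <;> rw [SetLike.mem_coe, Ideal.mem_span_singleton_mul]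
    · refine ⟨a * root A B Q, Ideal.mul_mem_left _ _ hr, ?_⟩
      rw [ha]; push_cast; ring
    · refine ⟨-b * root A B Q - c * Q.a,
        sub_mem (Ideal.mul_mem_left _ _ hr) (Ideal.mul_mem_left _ _ hqa), ?_⟩
      change _ = root A B Q * root A B Q
      rw [root_mul_self hQ, hb, hc]; push_cast; ring
  set I := Ideal.span {(g : QuadraticAlgebra ℤ A B)} * ideal A B Q with hI
  have hle2 : Ideal.span {root A B Q} * (I * conjIdeal I) ≤
      Ideal.span {(d : QuadraticAlgebra ℤ A B)} * (I * conjIdeal I) := by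
    have := Ideal.mul_mono_left (K := Ideal.span {(g : QuadraticAlgebra ℤ A B)} * conjIdeal I) hle
    rw [hI] at this ⊢
    convert this using 1 <;> ring
  rw [h.2, Ideal.span_singleton_mul_span_singleton, Ideal.span_singleton_mul_span_singleton,
    Ideal.span_singleton_le_span_singleton, ← Int.cast_mul, intCast_dvd_iff] at hle2
  have h3 := hle2.2
  simp [root_im] at h3
  have h4 : d ∣ 1 := by
    rw [← mul_dvd_mul_iff_right h.1.ne']; simpa using h3
  have h5 := Int.eq_one_of_dvd_one (by positivity) h4
  rw [hd] at h5
  exact_mod_cast h5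

/-- An ideal of positive norm is, up to an integer factor, the ideal of a form. -/
theorem exists_eq_span_mul_ideal (hD : B ^ 2 + 4 * A < 0)
    {I : Ideal (QuadraticAlgebra ℤ A B)} {n : ℤ} (hI : HasNorm I n) :
    ∃ (g : ℤ) (Q : BinaryForm), g ≠ 0 ∧ (Q.PosDef ∧ Q.Primitive ∧ Q.disc = B ^ 2 + 4 * A) ∧
      I = Ideal.span {(g : QuadraticAlgebra ℤ A B)} * ideal A B Q := by
  have hn : (n : QuadraticAlgebra ℤ A B) ∈ I := hI.intCast_mem
  let M : Ideal ℤ := I.comap (Int.castRingHom _)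
  have hM : ∀ t : ℤ, t ∈ M ↔ (t : QuadraticAlgebra ℤ A B) ∈ I := fun t => Iff.rfl
  -- `m` generates `I ∩ ℤ`; below, `g` generates the second coordinates of elements of `I`, and `ξ`
  -- attains `g`.
  obtain ⟨m, hm0, hmM⟩ : ∃ m : ℤ, 0 < m ∧ ∀ t : ℤ, (t : QuadraticAlgebra ℤ A B) ∈ I ↔ m ∣ t := by
    obtain ⟨m, hm⟩ := (IsPrincipalIdealRing.principal M).principal
    have hm' : ∀ t : ℤ, (t : QuadraticAlgebra ℤ A B) ∈ I ↔ m ∣ t := fun t => by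
      rw [← hM, hm]; exact Ideal.mem_span_singleton
    refine ⟨|m|, abs_pos.2 ?_, fun t => by rw [hm', abs_dvd]⟩
    rintro rfl
    exact hI.1.ne' (zero_dvd_iff.1 ((hm' n).1 hn))
  let N : Ideal ℤ := (I.restrictScalars ℤ).map (imₗ A B)
  have hN : ∀ t : ℤ, t ∈ N ↔ ∃ z ∈ I, z.im = t := fun t => Submodule.mem_map
  have hmI : (m : QuadraticAlgebra ℤ A B) ∈ I := (hmM m).2 dvd_rfl
  have hmN : m ∈ N := (hN m).2 ⟨(omega : QuadraticAlgebra ℤ A B) * m, Ideal.mul_mem_left _ _ hmI, by simp⟩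
  obtain ⟨g, hg0, hgN⟩ : ∃ g : ℤ, 0 < g ∧ ∀ t : ℤ, t ∈ N ↔ g ∣ t := by
    obtain ⟨g, hg⟩ := (IsPrincipalIdealRing.principal N).principal
    have hg' : ∀ t : ℤ, t ∈ N ↔ g ∣ t := fun t => by rw [hg]; exact Ideal.mem_span_singleton
    refine ⟨|g|, abs_pos.2 ?_, fun t => by rw [hg', abs_dvd]⟩
    rintro rfl
    exact hm0.ne' (zero_dvd_iff.1 ((hg' m).1 hmN))
  obtain ⟨a, ha⟩ := (hgN m).1 hmN
  obtain ⟨ξ, hξ, hξg⟩ := (hN g).1 ((hgN g).2 dvd_rfl)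
  obtain ⟨k, hk⟩ : g ∣ ξ.re := by
    -- This is the second coordinate of `ω ξ`.
    have h1 : ξ.re + B * ξ.im ∈ N := (hN _).2 ⟨omega * ξ, Ideal.mul_mem_left _ _ hξ, by simp⟩
    rw [hgN, hξg] at h1
    exact (dvd_add_left (dvd_mul_left g B)).1 h1
  have ha0 : 0 < a := by
    rw [ha] at hm0
    exact (mul_pos_iff_of_pos_left hg0).1 hm0
  obtain ⟨c, hc⟩ : a ∣ k ^ 2 + B * k - A := by
    have h1 : ((g * (k ^ 2 + B * k - A) : ℤ) : QuadraticAlgebra ℤ A B) ∈ I := by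
      -- With `ξ = g (k + ω)`, multiplying by the conjugate of `k + ω` gives the integer `g N(k +
      -- ω)` in `I`.
      have h2 : ((g * (k ^ 2 + B * k - A) : ℤ) : QuadraticAlgebra ℤ A B) = ⟨k + B, -1⟩ * ξ := by
        ext
        · rw [re_intCast]; simp [hk, hξg]; ring
        · rw [im_intCast]; simp [hk, hξg]; ring
      rw [h2]
      exact Ideal.mul_mem_left _ _ hξ
    rw [hmM, ha] at h1
    exact Int.dvd_of_mul_dvd_mul_left hg0.ne' h1
  have hdisc : (⟨a, -(B + 2 * k), c⟩ : BinaryForm).disc = B ^ 2 + 4 * A := by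
    simp only [disc]; linear_combination 4 * hc
  have hroot : root A B ⟨a, -(B + 2 * k), c⟩ = ⟨k, 1⟩ := by
    have := two_mul_root_re hdisc
    ext
    · simp only at this ⊢; linarith
    · rfl
  have hξ' : ξ = g * root A B ⟨a, -(B + 2 * k), c⟩ := by
    rw [hroot]
    ext
    · simp [hk]
    · simp [hξg]
  have hIeq : I = Ideal.span {(g : QuadraticAlgebra ℤ A B)} * ideal A B ⟨a, -(B + 2 * k), c⟩ := by
    rw [ideal, Ideal.span_mul_span', Set.singleton_mul, Set.image_pair, ← hξ']
    simp only
    rw [← Int.cast_mul, ← ha]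
    apply le_antisymm
    · intro z hz
      obtain ⟨t, ht⟩ := (hgN z.im).1 ((hN _).2 ⟨z, hz, rfl⟩)
      have h1 : ((z.re - t * ξ.re : ℤ) : QuadraticAlgebra ℤ A B) = z - t * ξ := by
        ext
        · simp
        · simp [ht, hξg]; ring
      have h2 : ((z.re - t * ξ.re : ℤ) : QuadraticAlgebra ℤ A B) ∈ I := by
        rw [h1]; exact sub_mem hz (Ideal.mul_mem_left _ _ hξ)
      obtain ⟨s, hs⟩ := (hmM _).1 h2
      rw [hs] at h1
      push_cast at h1
      exact Ideal.mem_span_pair.2 ⟨s, t, by linear_combination h1⟩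
    · rw [Ideal.span_le]
      rintro z (rfl | rfl)
      · exact hmI
      · exact hξ
  refine ⟨g, _, hg0.ne', ⟨posDef_of_disc_neg ha0 (hdisc ▸ hD), ?_, hdisc⟩, hIeq⟩
  exact primitive_of_hasNorm_ideal hdisc (hIeq ▸ hI)

/-! ### Form classes as ideal classes. -/

/-- The ideal class attached to a form. -/
noncomputable def toClass
    (Q : {Q : BinaryForm // Q.PosDef ∧ Q.Primitive ∧ Q.disc = B ^ 2 + 4 * A}) :
    IdealClass A B :=
  idealClass (hasNorm_ideal Q.2.2.2 Q.2.1.a_pos Q.2.2.1)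

theorem toClass_eq_iff (Q R : {Q : BinaryForm // Q.PosDef ∧ Q.Primitive ∧ Q.disc = B ^ 2 + 4 * A}) :
    toClass Q = toClass R ↔ Q.1.ProperlyEquivalent R.1 := by
  rw [toClass, toClass, idealClass_eq_iff]
  constructor
  · rintro ⟨x, y, hx, hy, h⟩
    exact properlyEquivalent_of_span_mul_ideal_eq (Q.2.2.2 ▸ Q.2.1.disc_neg) Q.2.2.2 R.2.2.2
      Q.2.1.a_pos R.2.1.a_pos Q.2.2.1 R.2.2.1 hx hy h
  · intro h
    exact h.exists_span_mul_ideal_eq Q.2.2.2 Q.2.1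

theorem toClass_surjective (hD : B ^ 2 + 4 * A < 0) :
    Function.Surjective (toClass (A := A) (B := B)) := by
  intro g
  obtain ⟨I, n, hI, rfl⟩ := exists_idealClass_eq g
  obtain ⟨g, Q, hg, hQ, h⟩ := exists_eq_span_mul_ideal hD hI
  refine ⟨⟨Q, hQ⟩, (idealClass_eq_iff _ _).2 ⟨g, 1, by simpa using hg, by simp, ?_⟩⟩
  simpa using h.symm

theorem classNumber_eq_card (hD : B ^ 2 + 4 * A < 0) :
    classNumber (B ^ 2 + 4 * A) = Nat.card (IdealClass A B) := by
  refine Nat.card_congr (Equiv.ofBijective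
    (Quotient.lift toClass fun Q R h => (toClass_eq_iff Q R).2 h) ⟨?_, ?_⟩)
  · rintro ⟨Q⟩ ⟨R⟩ h
    exact Quotient.sound ((toClass_eq_iff Q R).1 h)
  · intro g
    obtain ⟨Q, rfl⟩ := toClass_surjective hD g
    exact ⟨Quotient.mk _ Q, rfl⟩

theorem toClass_opp (Q : {Q : BinaryForm // Q.PosDef ∧ Q.Primitive ∧ Q.disc = B ^ 2 + 4 * A})
    (R : {Q : BinaryForm // Q.PosDef ∧ Q.Primitive ∧ Q.disc = B ^ 2 + 4 * A})
    (h : R.1 = Q.1.opp) : toClass R = (toClass Q)⁻¹ := by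
  obtain ⟨R, hR⟩ := R
  subst h
  refine eq_inv_of_mul_eq_one_right (Eq.trans ?_ (idealClass_mul_conj
    (hasNorm_ideal Q.2.2.2 Q.2.1.a_pos Q.2.2.1)))
  simp only [toClass, ideal_opp Q.2.2.2]
  rfl

/-- A substitution of determinant `-1` into `Q` becomes one of determinant `1` into the opposite
form once its second row is negated, and the opposite form has the conjugate ideal. -/
theorem toClass_eq_or_eq_inv_of_equivalent
    (Q R : {Q : BinaryForm // Q.PosDef ∧ Q.Primitive ∧ Q.disc = B ^ 2 + 4 * A})
    (h : Q.1.Equivalent R.1) : toClass R = toClass Q ∨ toClass R = (toClass Q)⁻¹ := by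
  obtain ⟨p, q, r, s, hd | hd, h⟩ := h
  · exact Or.inl ((toClass_eq_iff Q R).2 ⟨p, q, r, s, hd, h⟩).symm
  · right
    have hopp : Q.1.opp.disc = B ^ 2 + 4 * A := disc_opp.trans Q.2.2.2
    rw [← toClass_opp Q ⟨Q.1.opp, posDef_of_disc_neg (Q := Q.1.opp) Q.2.1.a_pos
      (disc_opp.trans_lt Q.2.1.disc_neg), Q.2.2.1.opp, hopp⟩ rfl, eq_comm, toClass_eq_iff]
    refine ⟨p, q, -r, -s, by linarith, fun x y => ?_⟩
    rw [h]
    simp only [eval, opp]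
    ring

theorem toClass_eq_one (Q : {Q : BinaryForm // Q.PosDef ∧ Q.Primitive ∧ Q.disc = B ^ 2 + 4 * A})
    (h : Q.1.a = 1) : toClass Q = 1 := by
  refine idealClass_eq_one_of_eq_span _ (x := 1) (by simp) ?_
  rw [ideal, h, Int.cast_one, Ideal.span_singleton_one, Ideal.eq_top_iff_one]
  exact Ideal.subset_span (by simp)

/-! ### Represented numbers as norms of ideals. -/

/-- A form represents the norms of the ideals in the inverse of its class. -/
theorem represents_of_classHasNorm
    (Q : {Q : BinaryForm // Q.PosDef ∧ Q.Primitive ∧ Q.disc = B ^ 2 + 4 * A}) {n : ℤ}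
    (h : ClassHasNorm (toClass Q)⁻¹ n) : Q.1.Represents n := by
  obtain ⟨I, hI, h⟩ := h
  have hD : B ^ 2 + 4 * A < 0 := Q.2.2.2 ▸ Q.2.1.disc_neg
  have hQ := hasNorm_ideal Q.2.2.2 Q.2.1.a_pos Q.2.2.1
  have h1 : idealClass (hI.mul hQ) = 1 :=
    (idealClass_mul hI hQ).trans (h ▸ inv_mul_cancel (toClass Q))
  obtain ⟨x, y, hx, hy, hxy⟩ := (idealClass_eq_one_iff _).1 h1
  have hn := (hI.mul hQ).norm_mul_eq hD hasNorm_one hx hy (by rw [hxy, mul_one])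
  have hmem : y ∈ Ideal.span {x} * (I * ideal A B Q.1) := by
    rw [hxy]; exact Ideal.mem_span_singleton_self y
  -- Here `z` lies in the ideal of `Q` and has norm `n a`, while norms from that ideal are `a` times
  -- values of `Q`.
  obtain ⟨z, hz, rfl⟩ := Ideal.mem_span_singleton_mul.1 hmem
  obtain ⟨u, v, rfl⟩ := (mem_ideal_iff Q.2.2.2 z).1 (Ideal.mul_le_right (I := I) hz)
  rw [map_mul, norm_mem_ideal Q.2.2.2, mul_one] at hn
  refine ⟨u, -v, ?_⟩
  refine mul_left_cancel₀ (mul_ne_zero hx Q.2.1.a_pos.ne') ?_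
  linear_combination -hn

/-- The product `a c` is the norm of a principal ideal. -/
theorem classHasNorm_one_mul
    (Q : {Q : BinaryForm // Q.PosDef ∧ Q.Primitive ∧ Q.disc = B ^ 2 + 4 * A}) :
    ClassHasNorm (1 : IdealClass A B) (Q.1.a * Q.1.c) := by
  rw [← norm_root Q.2.2.2]
  refine classHasNorm_one_norm ?_
  rw [norm_root Q.2.2.2]
  exact mul_pos Q.2.1.a_pos Q.2.1.c_pos

/-- The product `a c` is the norm of an ideal in the square of the class of the form. -/
theorem classHasNorm_sq_mul
    (Q : {Q : BinaryForm // Q.PosDef ∧ Q.Primitive ∧ Q.disc = B ^ 2 + 4 * A}) :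
    ClassHasNorm (toClass Q ^ 2) (Q.1.a * Q.1.c) := by
  have hI := hasNorm_ideal Q.2.2.2 Q.2.1.a_pos Q.2.2.1
  have hJ := hasNorm_ideal (Q := Q.1.swap) (disc_swap.trans Q.2.2.2) Q.2.1.c_pos Q.2.2.1.swap
  have h1 : idealClass hI * idealClass hJ = 1 := by
    rw [← idealClass_mul]
    refine idealClass_eq_one_of_eq_span _ ?_ (ideal_mul_ideal_swap Q.2.2.2 Q.2.2.1)
    rw [norm_root Q.2.2.2]
    exact (mul_pos Q.2.1.a_pos Q.2.1.c_pos).ne'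
  refine ⟨_, hI.mul hJ.conj, (idealClass_mul hI hJ.conj).trans ?_⟩
  have h2 := idealClass_mul_conj hJ
  rw [mul_comm] at h1
  -- The ideal of `Q` and the conjugate of the swapped ideal are both inverse to the swapped ideal,
  -- so their classes agree.
  rw [pow_two (toClass Q), ← mul_left_cancel (h1.trans h2.symm)]
  rfl

/-! ### Reduction of forms. -/

/-- Every positive definite form is properly equivalent to a reduced one. -/
theorem exists_reduced (hQ : Q.PosDef) : ∃ R : BinaryForm, Q.ProperlyEquivalent R ∧ R.Reduced := by
  classical
  have hex : ∃ n : ℕ, ∃ R : BinaryForm, Q.ProperlyEquivalent R ∧ R.a = n :=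
    ⟨Q.a.toNat, Q, .refl Q, (Int.toNat_of_nonneg hQ.a_pos.le).symm⟩
  obtain ⟨R, hR, hRa⟩ := Nat.find_spec hex
  have hmin : ∀ S : BinaryForm, Q.ProperlyEquivalent S → R.a ≤ S.a := by
    intro S hS
    have := Nat.find_min' hex ⟨S, hS, (Int.toNat_of_nonneg (hS.posDef hQ).a_pos.le).symm⟩
    have := (hS.posDef hQ).a_pos
    omega
  have ha := (hR.posDef hQ).a_pos
  obtain ⟨t, ht1, ht2⟩ : ∃ t : ℤ, -R.a < R.b + 2 * R.a * t ∧ R.b + 2 * R.a * t ≤ R.a := by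
    -- The `-1` makes the remainder land in `(-a, a]`, excluding `b = -a`.
    refine ⟨-((R.b + R.a - 1) / (2 * R.a)), ?_, ?_⟩ <;>
    · have h1 := Int.emod_add_mul_ediv (R.b + R.a - 1) (2 * R.a)
      have h2 := Int.emod_nonneg (R.b + R.a - 1) (b := 2 * R.a) (by omega)
      have h3 := Int.emod_lt_of_pos (R.b + R.a - 1) (b := 2 * R.a) (by omega)
      linarith
  let S : BinaryForm := ⟨R.a, R.b + 2 * R.a * t, R.eval t 1⟩
  have hS : Q.ProperlyEquivalent S := hR.trans ⟨1, t, 0, 1, by ring, fun x y => by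
    simp only [S, eval]; ring⟩
  let U : BinaryForm := ⟨S.c, -S.b, S.a⟩
  have hU : Q.ProperlyEquivalent U := hS.trans ⟨0, -1, 1, 0, by ring, fun x y => by
    simp only [U, eval]; ring⟩
  -- The leading coefficient is minimal in the class, and `c` is the leading coefficient of `U`.
  have hac : S.a ≤ S.c := hmin U hU
  by_cases hc : S.a = S.c ∧ S.b < 0
  · refine ⟨U, hU, ?_, ?_, ?_⟩
    · simp only [U, abs_neg]
      rw [← hc.1, abs_le]
      exact ⟨ht1.le, ht2⟩
    · exact hc.1.ge
    · intro _
      simp only [U]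
      linarith [hc.2]
  · refine ⟨S, hS, abs_le.2 ⟨ht1.le, ht2⟩, hac, ?_⟩
    rintro (h | h)
    · by_contra hlt
      push Not at hlt
      rw [abs_of_neg hlt] at h
      have : S.b = R.b + 2 * R.a * t := rfl
      have : S.a = R.a := rfl
      linarith
    · by_contra hlt
      exact hc ⟨h, not_le.1 hlt⟩

end BinaryForm

/-! ### Odd class number and the products. -/

theorem exists_pow_two_eq_of_odd_card {G : Type*} [Group G] (h : Odd (Nat.card G)) (x : G) :
    ∃ g : G, g ^ 2 = x := by
  obtain ⟨k, hk⟩ := h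
  refine ⟨x ^ (k + 1), ?_⟩
  rw [← pow_mul, show (k + 1) * 2 = Nat.card G + 1 by omega, pow_succ, pow_card_eq_one', one_mul]

namespace BinaryForm

open QuadraticAlgebra

theorem mem_forms {D : ℤ} {Q : BinaryForm} :
    Q ∈ forms D ↔ Q.PosDef ∧ Q.Primitive ∧ Q.Reduced ∧ Q.disc = D := by
  simp [forms]

theorem principal_a (D : ℤ) : (principal D).a = 1 := by
  unfold principal
  split_ifs <;> rfl

/-- Any `A`, `B` with the right discriminant present the order; taking them from the form avoids a
case split modulo `4`. -/
theorem exists_eq_of_posDef {D : ℤ} {Q : BinaryForm} (hQ : Q.PosDef) (hD : Q.disc = D) :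
    ∃ A B : ℤ, D = B ^ 2 + 4 * A ∧ B ^ 2 + 4 * A < 0 :=
  ⟨-(Q.a * Q.c), Q.b, by rw [← hD, disc]; ring, by
    have := hQ.disc_neg; rw [disc] at this; linarith⟩

/-- If the class number is odd, every form represents `m² ∏ a c`, the product being over any set of forms
that contains all non-principal classes up to equivalence. -/
theorem represents_sq_mul_prod {D : ℤ} (hodd : Odd (classNumber D)) {T : Finset BinaryForm}
    (hT : T ⊆ forms D) (hcov : ∀ R ∈ nonprincipalForms D, ∃ R' ∈ T, R.Equivalent R') (m : ℤ)
    {Q : BinaryForm} (hQ : Q ∈ forms D) : Q.Represents (m ^ 2 * ∏ R ∈ T, R.a * R.c) := by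
  obtain ⟨hQ1, hQ2, -, hQ3⟩ := mem_forms.1 hQ
  obtain ⟨A, B, rfl, hD⟩ := exists_eq_of_posDef hQ1 hQ3
  -- Norms of ideals are positive by definition, so `m = 0` is handled by the value at the origin.
  rcases eq_or_ne m 0 with rfl | hm
  · exact ⟨0, 0, by simp [eval]⟩
  have hform : ∀ R ∈ T, R.PosDef ∧ R.Primitive ∧ R.disc = B ^ 2 + 4 * A := fun R hR =>
    have h := mem_forms.1 (hT hR)
    ⟨h.1, h.2.1, h.2.2.2⟩
  have hprod : ∀ S ⊆ T, ClassHasNorm (1 : IdealClass A B) (∏ R ∈ S, R.a * R.c) := fun S hS =>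
    classHasNorm_one_prod S _ fun R hR => classHasNorm_one_mul ⟨R, hform R (hS hR)⟩
  have hm2 : ClassHasNorm (1 : IdealClass A B) (m ^ 2) := by
    have h : QuadraticAlgebra.norm (m : QuadraticAlgebra ℤ A B) = m ^ 2 := by simp
    rw [← h]
    exact classHasNorm_one_norm (h ▸ by positivity)
  refine represents_of_classHasNorm ⟨Q, hQ1, hQ2, hQ3⟩ ?_
  rw [← one_mul (toClass _)⁻¹]
  refine hm2.mul ?_
  rw [classNumber_eq_card hD] at hodd
  obtain ⟨g, hg⟩ := exists_pow_two_eq_of_odd_card hodd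
    (toClass (A := A) (B := B) ⟨Q, hQ1, hQ2, hQ3⟩)⁻¹
  rw [← hg]
  by_cases hg1 : g = 1
  · rw [hg1, one_pow]
    exact hprod T subset_rfl
  obtain ⟨P, rfl⟩ := toClass_surjective hD g
  obtain ⟨R, hPR, hR⟩ := exists_reduced P.2.1
  have hRf : R.PosDef ∧ R.Primitive ∧ R.disc = B ^ 2 + 4 * A :=
    ⟨hPR.posDef P.2.1, hPR.symm.primitive P.2.2.1, hPR.disc_eq.trans P.2.2.2⟩
  rw [(toClass_eq_iff P ⟨R, hRf⟩).2 hPR] at hg1 ⊢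
  have hRn : R ∈ nonprincipalForms (B ^ 2 + 4 * A) := by
    refine Finset.mem_erase.2 ⟨?_, mem_forms.2 ⟨hRf.1, hRf.2.1, hR, hRf.2.2⟩⟩
    intro h
    exact hg1 (toClass_eq_one _ (by simp only [h, principal_a]))
  obtain ⟨R', hR', hRR'⟩ := hcov R hRn
  rw [← Finset.mul_prod_erase T _ hR', ← mul_one (toClass _ ^ 2)]
  refine ClassHasNorm.mul ?_ (hprod _ (Finset.erase_subset _ _))
  have hsq := classHasNorm_sq_mul ⟨R', hform R' hR'⟩
  -- The representative in `T` may have class `g⁻¹`; conjugation then carries its norm `ac` from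
  -- `g⁻²` to `g²`.
  rcases toClass_eq_or_eq_inv_of_equivalent ⟨R, hRf⟩ ⟨R', hform R' hR'⟩ hRR' with h | h
  · rwa [h] at hsq
  · rw [h] at hsq
    have := hsq.inv
    rwa [inv_pow, inv_inv] at this

theorem Equivalent.refl (Q : BinaryForm) : Q.Equivalent Q :=
  ⟨1, 0, 0, 1, by norm_num, fun x y => by simp⟩

end BinaryForm

theorem theorem4 (D : ℤ) (hodd : Odd (BinaryForm.classNumber D)) :
    -- infinitely many positive integers are represented by all forms of discriminant `D`
    {n : ℤ | 0 < n ∧ ∀ Q ∈ BinaryForm.forms D, Q.Represents n}.Infinite ∧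
    -- the product over all non-principal forms
    (∀ m : ℤ, ∀ Q ∈ BinaryForm.forms D,
      Q.Represents (m ^ 2 * ∏ R ∈ BinaryForm.nonprincipalForms D, R.a * R.c)) ∧
    -- the product over representatives `T` of the non-principal forms up to (proper or improper)
    -- equivalence
    (∀ T : Finset BinaryForm, T ⊆ BinaryForm.nonprincipalForms D →
      (∀ R ∈ T, ∀ R' ∈ T, R.Equivalent R' → R = R') →
      (∀ R ∈ BinaryForm.nonprincipalForms D, ∃ R' ∈ T, R.Equivalent R') →
      ∀ m : ℤ, ∀ Q ∈ BinaryForm.forms D, Q.Represents (m ^ 2 * ∏ R ∈ T, R.a * R.c)) := by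
  have hsub : BinaryForm.nonprincipalForms D ⊆ BinaryForm.forms D := Finset.erase_subset _ _
  have hall : ∀ m : ℤ, ∀ Q ∈ BinaryForm.forms D,
      Q.Represents (m ^ 2 * ∏ R ∈ BinaryForm.nonprincipalForms D, R.a * R.c) := fun m Q hQ =>
    BinaryForm.represents_sq_mul_prod hodd hsub (fun R hR => ⟨R, hR, .refl R⟩) m hQ
  have hpos : 0 < ∏ R ∈ BinaryForm.nonprincipalForms D, R.a * R.c :=
    Finset.prod_pos fun R hR =>
      have h := (BinaryForm.mem_forms.1 (hsub hR)).1
      mul_pos h.a_pos h.c_pos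
  refine ⟨?_, hall, fun T hT _ hcov m Q hQ =>
    BinaryForm.represents_sq_mul_prod hodd (hT.trans hsub) hcov m hQ⟩
  -- Using `k + 1` keeps the multiplier nonzero, so the values are positive.
  refine Set.infinite_of_injective_forall_mem (f := fun k : ℕ =>
    ((k : ℤ) + 1) ^ 2 * ∏ R ∈ BinaryForm.nonprincipalForms D, R.a * R.c) ?_ fun k => ⟨?_, hall _⟩
  · intro k l h
    have h1 := mul_right_cancel₀ hpos.ne' h
    have h2 := (pow_left_inj₀ (by positivity) (by positivity) two_ne_zero).1 h1
    exact_mod_cast add_right_cancel h2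
  · exact mul_pos (by positivity) hpos
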